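/- Let $\mathbb K$ be a non-archimedean local field (a locally compact, non-discrete, totally disconnected topological field), with absolute value $|\cdot|$ normalized by $d(\alpha x)=|\alpha|\,dx$ for $\alpha\neq0$ and $|0|=0$. Put $\mathfrak D=\{x:|x|\le 1\}$, $\mathfrak P=\{x:|x|<1\}$ and $\mathfrak P^{-1}=\{x: x\mathfrak P\subseteq\mathfrak D\}$. Let $dx$ be the Haar measure on $(\mathbb K,+)$ with $\int_{\mathfrak D}dx=1$, and let $\chi$ be a continuous unitary character of $(\mathbb K,+)$ that is trivial on $\mathfrak D$ and nontrivial on $\mathfrak P^{-1}$. Let $\hat g$ denote the Fourier transform of $g\in L^2(\mathbb K)$, that is, the continuous extension to $L^2(\mathbb K)$ of $\hat g(\xi)=\int_{\mathbb K} g(x)\chi(-\xi x)\,dx$, $g\in L^1(\mathbb K)\cap L^2(\mathbb K)$. Let $\psi\in L^2(\mathbb K)$, $\psi\ne 0$, be an admissible wavelet, i.e. $$c_\psi=\int_{\mathbb K}\frac{|\hat\psi(\xi)|^2}{|\xi|}\,d\xi<\infty .$$ For $a,b\in\mathbb K$, $a\ne0$, put $\psi_{a,b}(x)=|a|^{-1/2}\,\psi\big(\tfrac{x-b}{a}\big)$,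 and for $f\in L^2(\mathbb K)$ put $K_\psi f(a,b)=\int_{\mathbb K} f(x)\overline{\psi_{a,b}(x)}\,dx$. **Theorem (Inversion Formula).** For every $f\in L^2(\mathbb K)$, $$f(x)=\frac1{c_\psi}\int_{\mathbb K}\int_{\mathbb K}K_\psi f(a,b)\,\psi_{a,b}(x)\,\frac{da\,db}{|a|^2}$$ in the weak sense: for every $h\in L^2(\mathbb K)$ the function $(a,b)\mapsto\int_{\mathbb K}K_\psi f(a,b)\,\psi_{a,b}(x)\,\overline{h(x)}\,dx$ is integrable on $\mathbb K\times\mathbb K$ with respect to $\frac{da\,db}{|a|^2}$, and $$\int_{\mathbb K}f(x)\overline{h(x)}\,dx=\frac1{c_\psi}\int_{\mathbb K}\int_{\mathbb K}\left(\int_{\mathbb K}K_\psi f(a,b)\,\psi_{a,b}(x)\,\overline{h(x)}\,dx\right)\frac{da\,db}{|a|^2}.$$ -/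

import Mathlib

open MeasureTheory Filter Topology
open scoped ENNReal NNReal ComplexConjugate

noncomputable section

namespace LocalFieldWavelet

section AbsoluteValue

variable {K : Type*} [Field K] [TopologicalSpace K] [IsTopologicalRing K] [LocallyCompactSpace K]

open Classical in
/-- The normalized absolute value of a locally compact field: `d(αx) = |α| dx` for a (any)
additive Haar measure `dx` if `α ≠ 0`, and `|0| = 0`. -/
def absVal (α : K) : ℝ≥0 :=
  if h : α = 0 then 0 else distribHaarChar K (Units.mk0 α h)

variable (K) in
/-- The ring of integers `𝔇 = {x : |x| ≤ 1}`. -/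
def integers : Set K := {x | absVal x ≤ 1}

variable (K) in
/-- The prime ideal `𝔓 = {x : |x| < 1}`. -/
def primeIdeal : Set K := {x | absVal x < 1}

variable (K) in
/-- The fractional ideal `𝔓⁻¹ = {x : x 𝔓 ⊆ 𝔇}`. -/
def primeIdealInv : Set K := {x | ∀ y ∈ primeIdeal K, x * y ∈ integers K}

end AbsoluteValue

section Fourier

variable {K : Type*} [Field K] [MeasurableSpace K]

/-- `g` is an `L²` Fourier transform of `f`: it is the `L²` limit of the Fourier integrals
`ξ ↦ ∫ uₙ(x) χ(-ξx) dx` of some sequence `uₙ` in `L¹ ∩ L²` that converges to `f` in `L²`. -/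
def IsFourierL2 (χ : AddChar K Circle) (μ : Measure K) (f g : K → ℂ) : Prop :=
  MemLp g 2 μ ∧ ∃ u : ℕ → K → ℂ,
    (∀ n, Integrable (u n) μ ∧ MemLp (u n) 2 μ) ∧
    Tendsto (fun n => eLpNorm (u n - f) 2 μ) atTop (𝓝 0) ∧
    Tendsto (fun n => eLpNorm (Fourier.fourierIntegral χ μ (u n) - g) 2 μ) atTop (𝓝 0)

open Classical in
/-- The Fourier transform on `L²`, the continuous extension of the Fourier integral from
`L¹ ∩ L²`. As for any element of `L²`, its values are determined almost everywhere only; the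
value `0` is a convention for functions that have no Fourier transform in this sense. -/
def fourierL2 (χ : AddChar K Circle) (μ : Measure K) (f : K → ℂ) : K → ℂ :=
  if h : ∃ g, IsFourierL2 χ μ f g then h.choose else 0

end Fourier

section Wavelet

variable {K : Type*} [Field K] [TopologicalSpace K] [IsTopologicalRing K] [LocallyCompactSpace K]
  [MeasurableSpace K]

/-- The constant `c_ψ = ∫ |ψ̂(ξ)|² / |ξ| dξ`, possibly infinite. -/
def admissibilityConst (χ : AddChar K Circle) (μ : Measure K) (ψ : K → ℂ) : ℝ≥0∞ :=
  ∫⁻ ξ, ‖fourierL2 χ μ ψ ξ‖ₑ ^ 2 / (absVal ξ : ℝ≥0∞) ∂μ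

/-- Admissible wavelets: `ψ ∈ L²` and `c_ψ < ∞`. -/
structure IsAdmissible (χ : AddChar K Circle) (μ : Measure K) (ψ : K → ℂ) : Prop where
  memLp : MemLp ψ 2 μ
  const_lt_top : admissibilityConst χ μ ψ < ∞

/-- The daughter wavelet `ψ_{a,b}(x) = |a|^{-1/2} ψ((x - b) / a)`, for `a ≠ 0`. -/
def daughter (ψ : K → ℂ) (a b x : K) : ℂ :=
  ((1 / Real.sqrt (absVal a : ℝ) : ℝ) : ℂ) * ψ ((x - b) / a)

/-- The continuous wavelet transform `K_ψ f(a,b) = ∫ f(x) conj(ψ_{a,b}(x)) dx`. -/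
def cwt (μ : Measure K) (ψ f : K → ℂ) (a b : K) : ℂ :=
  ∫ x, f x * conj (daughter ψ a b x) ∂μ

/-- The measure `da db / |a|²` on `K × K`. (The set `a = 0` is null for `da db`.) -/
def scaleMeasure (μ : Measure K) : Measure (K × K) :=
  (μ.prod μ).withDensity fun p => (((absVal p.1 ^ 2)⁻¹ : ℝ≥0) : ℝ≥0∞)

end Wavelet

end LocalFieldWavelet

end

set_option linter.unusedSectionVars false

namespace LocalFieldWavelet

open ValuativeRel
open scoped Pointwise

/-! The inner integral equals `K_ψ f(a,b)` times the conjugate of `K_ψ h(a,b)`, so the theorem says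
that `f ↦ K_ψ f` multiplies inner products by `c_ψ` on its way from `L²(K)` to `L²(da db/|a|²)`. By
polarization it is enough that squared norms are multiplied by `c_ψ` (`lintegral_cwt_sq`), and `c_ψ
≠ 0` allows the division.

For the norms, let `φ` and `g` be the transforms of `f` and `ψ`. Parseval shows that, for fixed `a ≠
0`, `K_ψ f(a,b)` is `|a|^{1/2}` times the Fourier integral of `φ(ξ) conj(g(aξ))` at `-b`
(`cwt_eq_fourierIntegral`). Plancherel in `b` gives `|a| ∫ |φ(ξ)|² |g(aξ)|² dξ`. Integrating against
`|a|⁻² da`, Tonelli and the invariance of `da/|a|` under `a ↦ aξ` turn this into `c_ψ ‖φ‖² = c_ψ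
‖f‖²`.

Plancherel rests on the fact that the indicator of `𝔇` is its own Fourier transform. The transform
of the autocorrelation of `u` is `|û|²`; integrating it over the growing balls `p⁻ⁿ𝔇`, where `|p| <
1`, gives the mean of the autocorrelation over `pⁿ𝔇`, which tends to its value `‖u‖²` at `0`.
Density of `L¹ ∩ L²` extends the isometry to `L²`. -/

theorem t2Space_and_secondCountableTopology (K : Type*) [Field K] [ValuativeRel K]
    [TopologicalSpace K] [IsNonarchimedeanLocalField K] :
    T2Space K ∧ SecondCountableTopology K := by
  let := IsTopologicalAddGroup.rightUniformSpace K
  have := isUniformAddGroup_of_addCommGroup (G := K)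
  -- A rank one valuation makes `K` a locally compact normed field, hence a proper space, hence
  -- second countable.
  let : (Valued.v (R := K)).RankOne :=
  { hom' := IsRankLeOne.nonempty.some.emb (R := K).comp MonoidWithZeroHom.ValueGroup₀.embedding
    strictMono' := IsRankLeOne.nonempty.some.strictMono.comp
        MonoidWithZeroHom.ValueGroup₀.embedding_strictMono }
  open scoped Valued in
  have : ProperSpace K := .of_nontriviallyNormedField_of_weaklyLocallyCompactSpace K
  exact ⟨inferInstance, secondCountable_of_proper⟩

theorem t2Space (K : Type*) [Field K] [ValuativeRel K] [TopologicalSpace K]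
    [IsNonarchimedeanLocalField K] : T2Space K :=
  (t2Space_and_secondCountableTopology K).1

theorem secondCountableTopology (K : Type*) [Field K] [ValuativeRel K] [TopologicalSpace K]
    [IsNonarchimedeanLocalField K] : SecondCountableTopology K :=
  (t2Space_and_secondCountableTopology K).2

attribute [local instance] t2Space secondCountableTopology

/-! ### The normalized absolute value and the ring of integers -/

section Field

variable {K : Type*} [Field K] [ValuativeRel K] [TopologicalSpace K]
    [IsNonarchimedeanLocalField K]

theorem absVal_of_ne_zero {a : K} (ha : a ≠ 0) :
    absVal a = distribHaarChar K (Units.mk0 a ha) := by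
  simp [absVal, ha]

@[simp] theorem absVal_zero : absVal (0 : K) = 0 := by simp [absVal]

@[simp] theorem absVal_one : absVal (1 : K) = 1 := by
  rw [absVal_of_ne_zero one_ne_zero, Units.mk0_one, map_one]

theorem absVal_pos {a : K} (ha : a ≠ 0) : 0 < absVal a := by
  rw [absVal_of_ne_zero ha]; exact distribHaarChar_pos

theorem absVal_ne_zero {a : K} (ha : a ≠ 0) : absVal a ≠ 0 := (absVal_pos ha).ne'

theorem absVal_mul (a b : K) : absVal (a * b) = absVal a * absVal b := by
  by_cases ha : a = 0
  · simp [ha]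
  by_cases hb : b = 0
  · simp [hb]
  rw [absVal_of_ne_zero ha, absVal_of_ne_zero hb, absVal_of_ne_zero (mul_ne_zero ha hb),
    Units.mk0_mul, map_mul]

theorem absVal_inv (a : K) : absVal a⁻¹ = (absVal a)⁻¹ := by
  by_cases ha : a = 0
  · simp [ha]
  exact eq_inv_of_mul_eq_one_left (by rw [← absVal_mul, inv_mul_cancel₀ ha, absVal_one])

theorem absVal_pow (a : K) (n : ℕ) : absVal (a ^ n) = absVal a ^ n := by
  induction n with
  | zero => simp
  | succ n ih => rw [pow_succ, pow_succ, absVal_mul, ih]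

section Measure

variable [MeasurableSpace K] [BorelSpace K] (μ : Measure K) [μ.IsAddHaarMeasure]

theorem measure_smul_set {a : K} (ha : a ≠ 0) (s : Set K) :
    μ (a • s) = absVal a * μ s := by
  rw [absVal_of_ne_zero ha, distribHaarChar_mul μ (Units.mk0 a ha) s]
  rfl

theorem map_mul_left {a : K} (ha : a ≠ 0) :
    μ.map (a * ·) = (absVal a)⁻¹ • μ := by
  ext s hs
  rw [Measure.map_apply (measurable_const_mul a) hs]
  have : (a * ·) ⁻¹' s = a⁻¹ • s := by
    rw [← Set.preimage_smul₀ ha]; rfl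
  rw [this, measure_smul_set μ (inv_ne_zero ha), absVal_inv]
  rfl

theorem lintegral_comp_mul_left {a : K} (ha : a ≠ 0) (f : K → ℝ≥0∞) :
    ∫⁻ x, f (a * x) ∂μ = (absVal a : ℝ≥0∞)⁻¹ * ∫⁻ x, f x ∂μ := by
  have h := lintegral_map_equiv (μ := μ) f (Homeomorph.mulLeft₀ a ha).toMeasurableEquiv
  simp only [Homeomorph.toMeasurableEquiv_coe, Homeomorph.coe_mulLeft₀] at h
  rw [← h, map_mul_left μ ha, lintegral_smul_measure, ENNReal.smul_def,
    ENNReal.coe_inv (absVal_ne_zero ha), smul_eq_mul]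

theorem integral_comp_mul_left {a : K} (ha : a ≠ 0) (f : K → ℂ) :
    ∫ x, f (a * x) ∂μ = ((absVal a : ℝ) : ℂ)⁻¹ * ∫ x, f x ∂μ := by
  have h := integral_map_equiv (μ := μ) (Homeomorph.mulLeft₀ a ha).toMeasurableEquiv f
  simp only [Homeomorph.toMeasurableEquiv_coe, Homeomorph.coe_mulLeft₀] at h
  rw [← h, map_mul_left μ ha, integral_smul_nnreal_measure, NNReal.smul_def]
  simp

theorem quasiMeasurePreserving_mul_left {a : K} (ha : a ≠ 0) :
    Measure.QuasiMeasurePreserving (a * ·) μ μ := by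
  refine ⟨measurable_const_mul a, ?_⟩
  rw [map_mul_left μ ha]
  exact Measure.smul_absolutelyContinuous

theorem memLp_comp_mul_left {a : K} (ha : a ≠ 0) {f : K → ℂ} {p : ℝ≥0∞} (hf : MemLp f p μ) :
    MemLp (fun x => f (a * x)) p μ := by
  have h : MemLp f p (μ.map (a * ·)) := by
    rw [map_mul_left μ ha]
    exact hf.smul_measure ENNReal.coe_ne_top
  exact h.comp_of_map (measurable_const_mul a).aemeasurable

end Measure

theorem isOpen_integers_valuation : IsOpen {x : K | valuation K x ≤ 1} := by
  let := IsTopologicalAddGroup.rightUniformSpace K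
  have := isUniformAddGroup_of_addCommGroup (G := K)
  have := Valued.isOpen_closedBall K (r := 1) one_ne_zero
  simpa [IsValuativeTopology.v_eq_valuation, Valuation.restrict_le_one_iff] using this

/-- Compare the Haar measures of the valuation ring `O` and its dilates. If `v(x) ≤ 1` then `xO ⊆
O`, so `|x| ≤ 1`. If `v(x) > 1` then `x⁻¹O` is a compact subset of `O` that misses `1`; the rest of
`O` is open and nonempty, so `x⁻¹O` has strictly smaller measure. This identification makes `𝔇` a
compact open additive subgroup. -/
theorem absVal_le_one_iff (x : K) : absVal x ≤ 1 ↔ valuation K x ≤ 1 := by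
  let : MeasurableSpace K := borel K
  have : BorelSpace K := ⟨rfl⟩
  set O : Set K := {x | valuation K x ≤ 1} with hO
  have hcomp : IsCompact O := IsNonarchimedeanLocalField.isCompact_closedBall K 1
  have hopen : IsOpen O := isOpen_integers_valuation
  let μ : Measure K := Measure.addHaar
  have hpos : μ O ≠ 0 := (hopen.measure_pos μ ⟨0, by simp [hO]⟩).ne'
  have hfin : μ O ≠ ∞ := hcomp.measure_lt_top.ne
  by_cases hx : x = 0
  · simp [hx]
  constructor
  · intro h
    by_contra! hv
    have hxi : valuation K x⁻¹ < 1 := by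
      rw [map_inv₀]; exact inv_lt_one_of_one_lt₀ hv
    have hsub : x⁻¹ • O ⊆ {y | valuation K y < 1} := by
      rintro _ ⟨y, hy, rfl⟩
      simp only [smul_eq_mul, Set.mem_ofPred_eq, map_mul]
      exact mul_lt_one_of_lt_of_le hxi hy
    have hcl : IsClosed (x⁻¹ • O) := (hcomp.smul x⁻¹).isClosed
    have hUpos : 0 < μ (O \ x⁻¹ • O) :=
      (hopen.sdiff hcl).measure_pos μ ⟨1, by simp [hO], fun h1 => by simpa using hsub h1⟩
    have hss : x⁻¹ • O ⊆ O := fun y hy =>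
      show valuation K y ≤ 1 from le_of_lt (hsub hy)
    have hlt : μ (x⁻¹ • O) < μ O := by
      rw [measure_sdiff hss hcl.nullMeasurableSet (measure_ne_top_of_subset hss hfin)] at hUpos
      exact tsub_pos_iff_lt.mp hUpos
    refine hlt.not_ge ?_
    rw [measure_smul_set μ (inv_ne_zero hx), absVal_inv]
    have h1 : (1 : ℝ≥0) ≤ (absVal x)⁻¹ := (one_le_inv₀ (absVal_pos hx)).mpr h
    exact le_mul_of_one_le_left zero_le (by exact_mod_cast h1)
  · intro hv
    have hss : x • O ⊆ O := by
      rintro _ ⟨y, hy, rfl⟩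
      simp only [smul_eq_mul, hO, Set.mem_ofPred_eq, map_mul]
      exact mul_le_one' hv hy
    have := measure_mono (μ := μ) hss
    rw [measure_smul_set μ hx] at this
    have h2 : (absVal x : ℝ≥0∞) ≤ 1 := by
      by_contra! hc
      have := ENNReal.mul_lt_mul_left hpos hfin hc
      rw [one_mul] at this
      exact this.not_ge ‹_›
    exact_mod_cast h2

theorem integers_eq : integers K = {x : K | valuation K x ≤ 1} :=
  Set.ext absVal_le_one_iff

theorem isOpen_integers : IsOpen (integers K) := integers_eq (K := K) ▸ isOpen_integers_valuation

theorem isCompact_integers : IsCompact (integers K) :=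
  integers_eq (K := K) ▸ IsNonarchimedeanLocalField.isCompact_closedBall K 1

theorem add_mem_integers {x y : K} (hx : x ∈ integers K) (hy : y ∈ integers K) :
    x + y ∈ integers K := by
  rw [integers_eq] at *
  exact ((valuation K).map_add x y).trans (max_le (show valuation K x ≤ 1 from hx) hy)

theorem neg_mem_integers {x : K} (hx : x ∈ integers K) : -x ∈ integers K := by
  rw [integers_eq] at *
  simpa using hx

theorem add_mem_integers_iff {x y : K} (hx : x ∈ integers K) :
    x + y ∈ integers K ↔ y ∈ integers K :=
  ⟨fun h => by simpa using add_mem_integers (neg_mem_integers hx) h, add_mem_integers hx⟩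

variable (K) in
theorem exists_absVal_lt_one : ∃ p : K, p ≠ 0 ∧ absVal p < 1 := by
  obtain ⟨p, hp0, hp⟩ := Valuation.IsNontrivial.exists_lt_one (v := valuation K)
  have hp0 : p ≠ 0 := by simpa using hp0
  refine ⟨p, hp0, ?_⟩
  by_contra! h
  have : absVal p⁻¹ ≤ 1 := by
    rw [absVal_inv]; exact inv_le_one_of_one_le₀ h
  rw [absVal_le_one_iff, map_inv₀] at this
  have hpos : 0 < valuation K p := by simpa [zero_lt_iff] using hp0
  exact hp.not_ge ((inv_le_one₀ hpos).mp this)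

theorem tendsto_pow_zero {p : K} (hp : absVal p < 1) :
    Tendsto (fun n : ℕ => p ^ n) atTop (𝓝 0) := by
  rw [(IsValuativeTopology.hasBasis_nhds_zero' K).tendsto_right_iff]
  intro γ hγ
  obtain ⟨r, rfl⟩ := ValuativeRel.valuation_surjective γ
  have hr : r ≠ 0 := by simpa using hγ
  have h1 : Tendsto (fun n : ℕ => absVal p ^ n) atTop (𝓝 0) :=
    tendsto_pow_atTop_nhds_zero_of_lt_one zero_le hp
  filter_upwards [h1.eventually_lt_const (absVal_pos hr)] with n hn
  by_contra! hc
  by_cases hp0 : p ^ n = 0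
  · rw [hp0] at hc; simp [hr] at hc
  -- Applied to a quotient, `absVal_le_one_iff` turns any comparison of valuations into one of
  -- absolute values.
  have h2 : absVal (r / p ^ n) ≤ 1 := by
    rw [absVal_le_one_iff, map_div₀]
    exact div_le_one_of_le₀ hc zero_le
  rw [div_eq_mul_inv, absVal_mul, absVal_inv, ← div_eq_mul_inv,
    div_le_one (absVal_pos hp0), absVal_pow] at h2
  exact h2.not_gt hn

theorem eventually_pow_mul_mem_integers {p : K} (hp : absVal p < 1) (x : K) :
    ∀ᶠ n : ℕ in atTop, p ^ n * x ∈ integers K := by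
  have h1 : Tendsto (fun n : ℕ => p ^ n * x) atTop (𝓝 (0 * x)) := (tendsto_pow_zero hp).mul_const x
  rw [zero_mul] at h1
  exact h1.eventually (isOpen_integers.mem_nhds (by simp [integers]))

section Measure

variable [MeasurableSpace K] [BorelSpace K] (μ : Measure K) [μ.IsAddHaarMeasure]

/-- Dilation by `p` with `0 < |p| < 1` fixes `{0}` but multiplies its finite measure by `|p|`. -/
theorem measure_singleton_zero : μ {(0 : K)} = 0 := by
  obtain ⟨p, hp0, hp⟩ := exists_absVal_lt_one K
  have h := measure_smul_set μ hp0 {0}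
  have hfin : μ {(0 : K)} ≠ ∞ := isCompact_singleton.measure_lt_top.ne
  by_contra h0
  have h1 : (absVal p : ℝ≥0∞) < 1 := by exact_mod_cast hp
  have := ENNReal.mul_lt_mul_left h0 hfin h1
  rw [← h, one_mul] at this
  simp at this

theorem ae_ne_zero : ∀ᵐ x ∂μ, x ≠ (0 : K) := by
  rw [ae_iff]; simpa using measure_singleton_zero μ

/-- For `a ≠ 0`, `|a| = μ(a𝔇)/μ(𝔇)`, and `μ(a𝔇)` is the integral over `x` of the jointly measurable
function `1_𝔇(a⁻¹x)`. -/
theorem measurable_absVal : Measurable (absVal : K → ℝ≥0) := by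
  let μ : Measure K := Measure.addHaar
  have hpos : μ (integers K) ≠ 0 :=
    (isOpen_integers.measure_pos μ ⟨0, by simp [integers]⟩).ne'
  have hfin : μ (integers K) ≠ ∞ := isCompact_integers.measure_lt_top.ne
  have hm : Measurable fun a : K =>
      (∫⁻ x, (integers K).indicator (1 : K → ℝ≥0∞) (a⁻¹ * x) ∂μ) / μ (integers K) := by
    refine Measurable.div_const (Measurable.lintegral_prod_right ?_) _
    exact (measurable_one.indicator isOpen_integers.measurableSet).comp
      (measurable_fst.inv.mul measurable_snd)
  have h2 : (absVal : K → ℝ≥0) = fun a => ({0}ᶜ : Set K).indicator (fun a =>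
      ((∫⁻ x, (integers K).indicator (1 : K → ℝ≥0∞) (a⁻¹ * x) ∂μ)
        / μ (integers K)).toNNReal) a := by
    ext a
    by_cases ha : a = 0
    · simp [ha]
    · rw [Set.indicator_of_mem (by simpa using ha), lintegral_comp_mul_left μ (inv_ne_zero ha),
        lintegral_indicator_one isOpen_integers.measurableSet, ENNReal.mul_div_cancel_right hpos hfin,
        absVal_inv, ENNReal.coe_inv (inv_ne_zero (absVal_ne_zero ha)) |>.symm]
      simp
  rw [h2]
  exact hm.ennreal_toNNReal.indicator (measurableSet_singleton 0).compl

end Measure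

end Field

/-! ### Fourier integrals, the indicator of `𝔇` and autocorrelations -/

section Fourier

open Fourier (fourierIntegral)

variable {K : Type*} [Field K] [ValuativeRel K] [TopologicalSpace K]
    [IsNonarchimedeanLocalField K] [MeasurableSpace K] [BorelSpace K]
    {μ : Measure K} [μ.IsAddHaarMeasure] {χ : AddChar K Circle}

theorem fourierIntegral_eq_mul (u : K → ℂ) (ξ : K) :
    fourierIntegral χ μ u ξ = ∫ x, (χ (-(x * ξ)) : ℂ) * u x ∂μ := rfl

theorem continuous_mul_uncurry :
    Continuous fun p : K × K => LinearMap.mul K K p.1 p.2 := continuous_mul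

theorem continuous_fourierIntegral (hχ : Continuous χ) {u : K → ℂ} (hu : Integrable u μ) :
    Continuous (fourierIntegral χ μ u) :=
  VectorFourier.fourierIntegral_continuous hχ continuous_mul_uncurry hu

theorem fourierIntegral_add (hχ : Continuous χ) {u v : K → ℂ} (hu : Integrable u μ)
    (hv : Integrable v μ) :
    fourierIntegral χ μ (u + v) = fourierIntegral χ μ u + fourierIntegral χ μ v :=
  VectorFourier.fourierIntegral_add hχ continuous_mul_uncurry hu hv

theorem fourierIntegral_sub (hχ : Continuous χ) {u v : K → ℂ} (hu : Integrable u μ)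
    (hv : Integrable v μ) :
    fourierIntegral χ μ (u - v) = fourierIntegral χ μ u - fourierIntegral χ μ v := by
  have h := Fourier.fourierIntegral_const_smul χ μ v (-1)
  rw [neg_one_smul, neg_one_smul] at h
  rw [sub_eq_add_neg, fourierIntegral_add hχ hu hv.neg, h, ← sub_eq_add_neg]

theorem integral_fourierIntegral_mul_comm (hχ : Continuous χ) {u v : K → ℂ}
    (hu : Integrable u μ) (hv : Integrable v μ) :
    ∫ ξ, fourierIntegral χ μ u ξ * v ξ ∂μ = ∫ x, u x * fourierIntegral χ μ v x ∂μ := by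
  have h := VectorFourier.integral_fourierIntegral_smul_eq_flip (μ := μ) (ν := μ)
    (L := LinearMap.mul K K) hχ continuous_mul_uncurry hu hv
  rwa [LinearMap.flip_mul] at h

theorem fourierIntegral_comp_mul_left {a : K} (ha : a ≠ 0) (u : K → ℂ) (ξ : K) :
    fourierIntegral χ μ (fun x => u (a * x)) ξ
      = ((absVal a : ℝ) : ℂ)⁻¹ * fourierIntegral χ μ u (a⁻¹ * ξ) := by
  rw [fourierIntegral_eq_mul, fourierIntegral_eq_mul, ← integral_comp_mul_left μ ha]
  refine integral_congr_ae (ae_of_all _ fun x => ?_)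
  have : a * x * (a⁻¹ * ξ) = x * ξ := by field_simp
  simp only [this]

variable (K) in
/-- The indicator function of the ring of integers. -/
noncomputable def integersIndicator : K → ℂ := (integers K).indicator 1

theorem integrable_integersIndicator : Integrable (integersIndicator K) μ :=
  (integrable_indicator_iff isOpen_integers.measurableSet).2
    (integrableOn_const isCompact_integers.measure_lt_top.ne)

/-- If `|t| > 1` then `t⁻¹ ∈ 𝔓`, so `x t⁻¹ ∈ 𝔇` for every `x ∈ 𝔓⁻¹`, and the hypothesis at `x t⁻¹`
would make `χ` trivial on `𝔓⁻¹`. -/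
theorem mem_integers_of_char_eq_one (hχ_nontriv : ∃ x ∈ primeIdealInv K, χ x ≠ 1) {t : K}
    (ht : ∀ x ∈ integers K, χ (x * t) = 1) : t ∈ integers K := by
  by_contra h
  obtain ⟨x, hx, hx1⟩ := hχ_nontriv
  have ht1 : 1 < absVal t := not_le.mp h
  have ht0 : t ≠ 0 := by rintro rfl; simp at ht1
  have h1 : t⁻¹ ∈ primeIdeal K := by
    change absVal t⁻¹ < 1
    rw [absVal_inv]; exact inv_lt_one_of_one_lt₀ ht1
  apply hx1
  have := ht _ (hx _ h1)
  rwa [inv_mul_cancel_right₀ ht0] at this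

/-- For `t ∈ 𝔇` the character `x ↦ χ(-xt)` is trivial on `𝔇`, which has measure `1`. For `t ∉ 𝔇` it
is nontrivial on `𝔇`, and translating by a `y ∈ 𝔇` with `χ(yt) ≠ 1` shows that its integral over `𝔇`
vanishes. -/
theorem fourierIntegral_integersIndicator (hμ : μ (integers K) = 1)
    (hχ_triv : ∀ x ∈ integers K, χ x = 1) (hχ_nontriv : ∃ x ∈ primeIdealInv K, χ x ≠ 1) :
    fourierIntegral χ μ (integersIndicator K) = integersIndicator K := by
  ext t
  rw [fourierIntegral_eq_mul]
  have hO : ∀ x y : K, absVal x ≤ 1 → absVal y ≤ 1 → absVal (x * y) ≤ 1 := fun x y hx hy => by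
    rw [absVal_mul]; exact mul_le_one' hx hy
  by_cases ht : t ∈ integers K
  · have h1 : ∀ x, (χ (-(x * t)) : ℂ) * integersIndicator K x = integersIndicator K x := by
      intro x
      by_cases hx : x ∈ integers K
      · rw [hχ_triv _ (neg_mem_integers (hO x t hx ht))]; simp
      · simp [integersIndicator, hx]
    simp_rw [h1]
    simp only [integersIndicator]
    rw [integral_indicator isOpen_integers.measurableSet]
    simp [ht, hμ, measureReal_def]
  · have h2 : ∃ x ∈ integers K, χ (x * t) ≠ 1 := by
      by_contra! h
      exact ht (mem_integers_of_char_eq_one hχ_nontriv h)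
    obtain ⟨y, hy, hy1⟩ := h2
    set I := ∫ x, (χ (-(x * t)) : ℂ) * integersIndicator K x ∂μ with hI
    have h3 : I = (χ (y * t) : ℂ) * I := by
      rw [hI, ← integral_const_mul]
      conv_lhs => rw [← integral_add_left_eq_self _ (-y)]
      refine integral_congr_ae (ae_of_all _ fun x => ?_)
      have e1 : integersIndicator K (-y + x) = integersIndicator K x := by
        have := add_mem_integers_iff (y := x) (neg_mem_integers hy)
        by_cases hx : x ∈ integers K
        · simp [integersIndicator, hx, this.2 hx]
        · simp [integersIndicator, hx, mt this.1 hx]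
      have e2 : -((-y + x) * t) = y * t + -(x * t) := by ring
      simp only [e1, e2, AddChar.map_add_eq_mul, Circle.coe_mul, mul_assoc]
    have h4 : ((χ (y * t) : ℂ) - 1) * I = 0 := by rw [sub_mul, ← h3]; ring
    have h5 : (χ (y * t) : ℂ) - 1 ≠ 0 := by
      rw [sub_ne_zero]; exact fun h => hy1 (Circle.ext (by simpa using h))
    rw [(mul_eq_zero.mp h4).resolve_left h5]
    simp [integersIndicator, ht]

variable (μ) in
/-- The autocorrelation `t ↦ ∫ u(x + t) conj(u(x)) dx`. -/
noncomputable def autocorrelation (u : K → ℂ) (t : K) : ℂ := ∫ x, u (x + t) * conj (u x) ∂μ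

/-- The shear `(x, t) ↦ (x, x + t)` preserves `μ × μ` and reduces the kernel to a product of
integrable functions. -/
theorem integrable_autocorrelation_kernel {u : K → ℂ} (hu : Integrable u μ) :
    Integrable (fun p : K × K => u (p.1 + p.2) * conj (u p.1)) (μ.prod μ) := by
  have hc : Integrable (fun x => conj (u x)) μ := by
    simpa using (Complex.conjCLE.toContinuousLinearMap.integrable_comp hu)
  have h := (measurePreserving_prod_add μ μ).integrable_comp_of_integrable (hc.mul_prod hu)
  refine h.congr (ae_of_all _ fun p => ?_)
  simp [mul_comm]

theorem integrable_autocorrelation {u : K → ℂ} (hu : Integrable u μ) :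
    Integrable (autocorrelation μ u) μ :=
  (integrable_autocorrelation_kernel hu).integral_prod_right

/-- Fubini and the shift `t ↦ t - x` separate the variables. The point is to exhibit `|û|²` as the
transform of an integrable function. -/
theorem fourierIntegral_autocorrelation (hχ : Continuous χ) {u : K → ℂ} (hu : Integrable u μ)
    (ξ : K) :
    fourierIntegral χ μ (autocorrelation μ u) ξ
      = fourierIntegral χ μ u ξ * conj (fourierIntegral χ μ u ξ) := by
  have hint : Integrable (fun p : K × K => (χ (-(p.2 * ξ)) : ℂ) * (u (p.1 + p.2) * conj (u p.1)))
      (μ.prod μ) := by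
    refine (integrable_autocorrelation_kernel hu).bdd_mul (c := 1) ?_ (ae_of_all _ fun p =>
      (Circle.norm_coe _).le)
    refine Continuous.aestronglyMeasurable ?_
    exact continuous_induced_dom.comp (hχ.comp (by fun_prop))
  calc fourierIntegral χ μ (autocorrelation μ u) ξ
      = ∫ t, ∫ x, (χ (-(t * ξ)) : ℂ) * (u (x + t) * conj (u x)) ∂μ ∂μ := by
        rw [fourierIntegral_eq_mul]
        simp only [autocorrelation, integral_const_mul]
    _ = ∫ x, ∫ t, (χ (-(t * ξ)) : ℂ) * (u (x + t) * conj (u x)) ∂μ ∂μ :=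
        integral_integral_swap hint.swap
    _ = ∫ x, fourierIntegral χ μ u ξ * ((χ (x * ξ) : ℂ) * conj (u x)) ∂μ := by
        refine integral_congr_ae (ae_of_all _ fun x => ?_)
        simp only
        rw [← integral_add_left_eq_self _ (-x), fourierIntegral_eq_mul, ← integral_mul_const]
        refine integral_congr_ae (ae_of_all _ fun t => ?_)
        have e2 : -((-x + t) * ξ) = x * ξ + -(t * ξ) := by ring
        simp only [e2, AddChar.map_add_eq_mul, Circle.coe_mul, add_neg_cancel_left]
        ring
    _ = fourierIntegral χ μ u ξ * conj (fourierIntegral χ μ u ξ) := by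
        rw [integral_const_mul]
        congr 1
        rw [fourierIntegral_eq_mul, ← integral_conj]
        refine integral_congr_ae (ae_of_all _ fun x => ?_)
        simp only [map_mul, AddChar.map_neg_eq_inv, Circle.coe_inv_eq_conj, Complex.conj_conj]

/-- The value at `t` is the `L²` inner product of `u` with its translate by `t`. Translation is
continuous in `L²`, and Cauchy–Schwarz gives the bound `‖u‖²`. -/
theorem exists_autocorrelation_continuous_bounded {u : K → ℂ} (hu : MemLp u 2 μ) :
    Continuous (autocorrelation μ u) ∧ ∃ C : ℝ, ∀ t, ‖autocorrelation μ u t‖ ≤ C := by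
  let U : Lp ℂ 2 μ := hu.toLp u
  have hmp : ∀ t : K, MeasurePreserving (· + t) μ μ := fun t => measurePreserving_add_right μ t
  let g : C(K, C(K, K)) := (ContinuousMap.mk (fun p : K × K => p.2 + p.1) (by fun_prop)).curry
  let T : K → Lp ℂ 2 μ := fun t => Lp.compMeasurePreserving (g t) (hmp t) U
  have hT : Continuous T :=
    continuous_const.compMeasurePreservingLp g.continuous hmp (by simp)
  have heq : autocorrelation μ u = fun t => inner ℂ U (T t) := by
    ext t
    rw [L2.inner_def, autocorrelation]
    have h1 : U =ᵐ[μ] u := hu.coeFn_toLp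
    have h2 : T t =ᵐ[μ] U ∘ (· + t) := Lp.coeFn_compMeasurePreserving U (hmp t)
    have h3 : U ∘ (· + t) =ᵐ[μ] u ∘ (· + t) := (hmp t).quasiMeasurePreserving.ae_eq_comp h1
    refine integral_congr_ae ?_
    filter_upwards [h1, h2, h3] with x e1 e2 e3
    rw [e1, e2, e3]
    simp
  refine ⟨heq ▸ continuous_const.inner hT, ‖U‖ * ‖U‖, fun t => ?_⟩
  rw [heq]
  refine (norm_inner_le_norm _ _).trans_eq ?_
  exact congrArg _ (Lp.norm_compMeasurePreserving U (hmp t))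

end Fourier

/-! ### Square-integrable functions and polarization -/

section SquareIntegrable

variable {α β : Type*} [MeasurableSpace α] [MeasurableSpace β] {μ : Measure α} {ν : Measure β}

theorem eLpNorm_two_eq (f : α → ℂ) :
    eLpNorm f 2 μ = (∫⁻ x, ‖f x‖ₑ ^ 2 ∂μ) ^ (1 / 2 : ℝ) := by
  rw [eLpNorm_eq_lintegral_rpow_enorm_toReal (by simp) (by simp)]
  simp

theorem eLpNorm_two_eq_iff {f : α → ℂ} {g : β → ℂ} :
    eLpNorm f 2 μ = eLpNorm g 2 ν ↔ ∫⁻ x, ‖f x‖ₑ ^ 2 ∂μ = ∫⁻ x, ‖g x‖ₑ ^ 2 ∂ν := by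
  rw [eLpNorm_two_eq, eLpNorm_two_eq]
  exact (ENNReal.rpow_left_injective (by norm_num : (1 / 2 : ℝ) ≠ 0)).eq_iff

theorem memLp_two_iff_lintegral {f : α → ℂ} :
    MemLp f 2 μ ↔ AEStronglyMeasurable f μ ∧ ∫⁻ x, ‖f x‖ₑ ^ 2 ∂μ < ∞ := by
  rw [MemLp, eLpNorm_two_eq, ENNReal.rpow_lt_top_iff_of_pos (by norm_num)]

theorem integral_norm_sq_eq_toReal {f : α → ℂ} (hf : AEStronglyMeasurable f μ) :
    ∫ x, ‖f x‖ ^ 2 ∂μ = (∫⁻ x, ‖f x‖ₑ ^ 2 ∂μ).toReal := by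
  rw [integral_eq_lintegral_of_nonneg_ae (ae_of_all _ fun x => by positivity)
    ((continuous_pow 2).comp_aestronglyMeasurable hf.norm)]
  congr 1
  refine lintegral_congr fun x => ?_
  rw [← ofReal_norm, ENNReal.ofReal_pow (norm_nonneg _)]

/-- All four terms have the shape `‖z + c * w‖ ^ 2`, so that one norm identity quantified over `c`
covers them. -/
theorem mul_conj_eq_polarization (z w : ℂ) :
    z * conj w = (1 / 4 : ℂ) * (((‖z + 1 * w‖ ^ 2 : ℝ) : ℂ) - ((‖z + (-1) * w‖ ^ 2 : ℝ) : ℂ)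
      + Complex.I * ((‖z + Complex.I * w‖ ^ 2 : ℝ) : ℂ)
      - Complex.I * ((‖z + (-Complex.I) * w‖ ^ 2 : ℝ) : ℂ)) := by
  have h : ∀ v : ℂ, ((‖v‖ ^ 2 : ℝ) : ℂ) = v * conj v := fun v => by
    rw [Complex.mul_conj, Complex.normSq_eq_norm_sq]
  simp only [h, map_add, map_mul, map_neg, map_one, Complex.conj_I]
  linear_combination (z * conj w - w * conj z) / 2 * Complex.I_sq

theorem integral_mul_conj_eq_polarization {f g : α → ℂ} (hf : MemLp f 2 μ) (hg : MemLp g 2 μ) :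
    ∫ x, f x * conj (g x) ∂μ = (1 / 4 : ℂ) *
      (((∫ x, ‖f x + 1 * g x‖ ^ 2 ∂μ : ℝ) : ℂ) - ((∫ x, ‖f x + (-1) * g x‖ ^ 2 ∂μ : ℝ) : ℂ)
      + Complex.I * ((∫ x, ‖f x + Complex.I * g x‖ ^ 2 ∂μ : ℝ) : ℂ)
      - Complex.I * ((∫ x, ‖f x + (-Complex.I) * g x‖ ^ 2 ∂μ : ℝ) : ℂ)) := by
  have hi : ∀ c : ℂ, Integrable (fun x => ((‖f x + c * g x‖ ^ 2 : ℝ) : ℂ)) μ := fun c =>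
    (hf.add (hg.const_mul c)).integrable_norm_pow (by norm_num) |>.ofReal
  simp only [← integral_complex_ofReal, mul_conj_eq_polarization (f _)]
  have h1 := integral_sub (hi 1) (hi (-1))
  have h2 := integral_add ((hi 1).sub (hi (-1))) ((hi Complex.I).const_mul Complex.I)
  have h3 := integral_sub (((hi 1).sub (hi (-1))).add ((hi Complex.I).const_mul Complex.I))
    ((hi (-Complex.I)).const_mul Complex.I)
  simp only [Pi.add_apply, Pi.sub_apply] at h1 h2 h3
  rw [integral_const_mul, h3, h2, h1, integral_const_mul, integral_const_mul]

/-- A linear correspondence that scales `L²` norms scales inner products. -/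
theorem integral_mul_conj_eq_of_lintegral_eq {f g : α → ℂ} {f' g' : β → ℂ}
    (hf : MemLp f 2 μ) (hg : MemLp g 2 μ) (hf' : MemLp f' 2 ν) (hg' : MemLp g' 2 ν) (C : ℝ≥0∞)
    (h : ∀ c : ℂ, ∫⁻ x, ‖f x + c * g x‖ₑ ^ 2 ∂μ = C * ∫⁻ x, ‖f' x + c * g' x‖ₑ ^ 2 ∂ν) :
    ∫ x, f x * conj (g x) ∂μ = (C.toReal : ℂ) * ∫ x, f' x * conj (g' x) ∂ν := by
  have hc : ∀ c : ℂ, ∫ x, ‖f x + c * g x‖ ^ 2 ∂μ = C.toReal * ∫ x, ‖f' x + c * g' x‖ ^ 2 ∂ν := by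
    intro c
    have h1 := integral_norm_sq_eq_toReal (hf.1.add (hg.1.const_mul c))
    have h2 := integral_norm_sq_eq_toReal (hf'.1.add (hg'.1.const_mul c))
    simp only [Pi.add_apply] at h1 h2
    rw [h1, h2, h, ENNReal.toReal_mul]
  rw [integral_mul_conj_eq_polarization hf hg, integral_mul_conj_eq_polarization hf' hg']
  simp only [hc, Complex.ofReal_mul]
  ring

theorem tendsto_eLpNorm_of_tendsto_sub {u : ℕ → α → ℂ} {f : α → ℂ} (hu : ∀ n, MemLp (u n) 2 μ)
    (hf : MemLp f 2 μ) (h : Tendsto (fun n => eLpNorm (u n - f) 2 μ) atTop (𝓝 0)) :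
    Tendsto (fun n => eLpNorm (u n) 2 μ) atTop (𝓝 (eLpNorm f 2 μ)) := by
  have h1 := (Lp.tendsto_Lp_iff_tendsto_eLpNorm'' u hu f hf).2 h
  have h2 := h1.enorm
  simpa only [Lp.enorm_toLp] using h2

end SquareIntegrable

/-! ### The theorems of Plancherel and Parseval -/

section Plancherel

open Fourier (fourierIntegral)

variable {K : Type*} [Field K] [ValuativeRel K] [TopologicalSpace K]
    [IsNonarchimedeanLocalField K] [MeasurableSpace K] [BorelSpace K]
    {μ : Measure K} [μ.IsAddHaarMeasure] {χ : AddChar K Circle}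

/-- The multiplication formula moves the transform from the autocorrelation to `1_𝔇(a ·)`, whose
transform is `|a|⁻¹ 1_𝔇(a⁻¹ ·)`; the substitution `t ↦ at` absorbs the factor. For small `a` the
left side is a truncation of `‖û‖²` and the right side a local mean of the autocorrelation at `0`.
-/
theorem integral_fourierIntegral_sq_mul_integersIndicator (hμ : μ (integers K) = 1)
    (hχ : Continuous χ) (hχ_triv : ∀ x ∈ integers K, χ x = 1)
    (hχ_nontriv : ∃ x ∈ primeIdealInv K, χ x ≠ 1) {u : K → ℂ} (hu : Integrable u μ)
    {a : K} (ha : a ≠ 0) :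
    ∫ ξ, fourierIntegral χ μ u ξ * conj (fourierIntegral χ μ u ξ) * integersIndicator K (a * ξ) ∂μ
      = ∫ t, autocorrelation μ u (a * t) * integersIndicator K t ∂μ := by
  have hi : Integrable (fun ξ => integersIndicator K (a * ξ)) μ := by
    rw [← memLp_one_iff_integrable]
    exact memLp_comp_mul_left μ ha (memLp_one_iff_integrable.2 integrable_integersIndicator)
  simp_rw [← fourierIntegral_autocorrelation hχ hu]
  rw [integral_fourierIntegral_mul_comm hχ (integrable_autocorrelation hu) hi]
  have h := integral_comp_mul_left μ ha
    (fun t => autocorrelation μ u t * integersIndicator K (a⁻¹ * t))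
  simp only [inv_mul_cancel_left₀ ha] at h
  rw [h, ← integral_const_mul]
  refine integral_congr_ae (ae_of_all _ fun t => ?_)
  simp only [fourierIntegral_comp_mul_left ha,
    fourierIntegral_integersIndicator hμ hχ_triv hχ_nontriv]
  ring

theorem tendsto_integral_autocorrelation (hμ : μ (integers K) = 1) {u : K → ℂ}
    (hu : MemLp u 2 μ) {p : K} (hp : absVal p < 1) :
    Tendsto (fun n : ℕ => ∫ t, autocorrelation μ u (p ^ n * t) * integersIndicator K t ∂μ) atTop
      (𝓝 ((∫ x, ‖u x‖ ^ 2 ∂μ : ℝ) : ℂ)) := by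
  obtain ⟨hc, C, hC⟩ := exists_autocorrelation_continuous_bounded hu
  have h0 : ((∫ x, ‖u x‖ ^ 2 ∂μ : ℝ) : ℂ)
      = ∫ t, autocorrelation μ u 0 * integersIndicator K t ∂μ := by
    have h1 : ∫ t, integersIndicator K t ∂μ = 1 := by
      simp only [integersIndicator]
      rw [integral_indicator isOpen_integers.measurableSet]
      simp [hμ, measureReal_def]
    rw [integral_const_mul, h1, mul_one, autocorrelation, ← integral_complex_ofReal]
    refine integral_congr_ae (ae_of_all _ fun x => ?_)
    simp only [add_zero]
    rw [Complex.mul_conj, Complex.normSq_eq_norm_sq]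
  rw [h0]
  refine tendsto_integral_of_dominated_convergence (fun t => C * ‖integersIndicator K t‖)
    (fun n => ?_) (integrable_integersIndicator.norm.const_mul C) (fun n => ?_)
    (ae_of_all _ fun t => ?_)
  · exact (hc.comp (continuous_const_mul _)).aestronglyMeasurable.mul
      integrable_integersIndicator.1
  · refine ae_of_all _ fun t => ?_
    rw [norm_mul]
    exact mul_le_mul_of_nonneg_right (hC _) (norm_nonneg _)
  · refine Tendsto.mul_const _ ?_
    have := (tendsto_pow_zero hp).mul_const t
    rw [zero_mul] at this
    exact (hc.tendsto 0).comp this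

/-- Plancherel's theorem on `L¹ ∩ L²`. -/
theorem lintegral_fourierIntegral_sq (hμ : μ (integers K) = 1)
    (hχ : Continuous χ) (hχ_triv : ∀ x ∈ integers K, χ x = 1)
    (hχ_nontriv : ∃ x ∈ primeIdealInv K, χ x ≠ 1) {u : K → ℂ} (hu : Integrable u μ)
    (hu2 : MemLp u 2 μ) :
    ∫⁻ ξ, ‖fourierIntegral χ μ u ξ‖ₑ ^ 2 ∂μ = ∫⁻ x, ‖u x‖ₑ ^ 2 ∂μ := by
  obtain ⟨p, hp0, hp⟩ := exists_absVal_lt_one K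
  have hpn : ∀ n : ℕ, p ^ n ≠ 0 := fun n => pow_ne_zero n hp0
  set F := fourierIntegral χ μ u with hF
  have hFc : Continuous F := continuous_fourierIntegral hχ hu
  -- The balls `p⁻ⁿ𝔇` increase to `K`, so monotone convergence recovers the full integral of `|û|²`.
  let S : ℕ → Set K := fun n => {ξ | p ^ n * ξ ∈ integers K}
  have hS : ∀ n, MeasurableSet (S n) := fun n =>
    (isOpen_integers.preimage (continuous_const_mul (p ^ n))).measurableSet
  have hSmono : Monotone S := by
    refine monotone_nat_of_le_succ fun n ξ hξ => ?_
    change absVal (p ^ (n + 1) * ξ) ≤ 1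
    rw [pow_succ', mul_assoc, absVal_mul]
    exact mul_le_one' hp.le hξ
  have h1 : ∀ n, ∫⁻ ξ, (S n).indicator (fun ξ => ‖F ξ‖ₑ ^ 2) ξ ∂μ
      = ENNReal.ofReal (∫ t, autocorrelation μ u (p ^ n * t) * integersIndicator K t ∂μ).re := by
    intro n
    rw [← integral_fourierIntegral_sq_mul_integersIndicator hμ hχ hχ_triv hχ_nontriv hu (hpn n)]
    have e : ∀ ξ, F ξ * conj (F ξ) * integersIndicator K (p ^ n * ξ)
        = (((S n).indicator (fun ξ => ‖F ξ‖ ^ 2) ξ : ℝ) : ℂ) := by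
      intro ξ
      rw [Complex.mul_conj, Complex.normSq_eq_norm_sq]
      by_cases hξ : p ^ n * ξ ∈ integers K
      · have hξ' : ξ ∈ S n := hξ
        simp [integersIndicator, hξ, hξ']
      · have hξ' : ξ ∉ S n := hξ
        simp [integersIndicator, hξ, hξ']
    rw [← hF]
    simp_rw [e]
    rw [integral_complex_ofReal, Complex.ofReal_re, integral_eq_lintegral_of_nonneg_ae]
    · rw [ENNReal.ofReal_toReal]
      · refine lintegral_congr fun ξ => ?_
        by_cases hξ : ξ ∈ S n
        · simp only [hξ, Set.indicator_of_mem]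
          rw [← ofReal_norm, ENNReal.ofReal_pow (norm_nonneg _)]
        · simp [hξ]
      -- The truncated integral must be finite for `toReal` to lose nothing: `|û| ≤ ‖u‖₁`, and the
      -- ball has finite measure.
      · have hfin : μ (S n) ≠ ∞ := by
          have : S n = (p ^ n * ·) ⁻¹' integers K := rfl
          rw [this, ← Measure.map_apply (measurable_const_mul _) isOpen_integers.measurableSet,
            map_mul_left μ (hpn n), Measure.smul_apply, hμ]
          simp
        refine ne_top_of_le_ne_top (ENNReal.mul_ne_top (ENNReal.ofReal_ne_top
          (r := (∫ x, ‖u x‖ ∂μ) ^ 2)) hfin) ?_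
        rw [← lintegral_indicator_const (hS n)]
        refine lintegral_mono fun ξ => ?_
        by_cases hξ : ξ ∈ S n
        · simp only [hξ, Set.indicator_of_mem]
          refine ENNReal.ofReal_le_ofReal (pow_le_pow_left₀ (norm_nonneg _) ?_ 2)
          exact Fourier.norm_fourierIntegral_le_integral_norm χ μ u ξ
        · simp [hξ]
    · exact ae_of_all _ fun ξ => Set.indicator_nonneg (fun _ _ => by positivity) ξ
    · exact ((hFc.norm.pow 2).measurable.indicator (hS n)).aestronglyMeasurable
  have h2 : Tendsto (fun n => ∫⁻ ξ, (S n).indicator (fun ξ => ‖F ξ‖ₑ ^ 2) ξ ∂μ) atTop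
      (𝓝 (∫⁻ ξ, ‖F ξ‖ₑ ^ 2 ∂μ)) := by
    refine lintegral_tendsto_of_tendsto_of_monotone (fun n => ?_) (ae_of_all _ fun ξ => ?_)
      (ae_of_all _ fun ξ => ?_)
    · exact ((hFc.measurable.enorm.pow_const 2).indicator (hS n)).aemeasurable
    · exact fun m n hmn => Set.indicator_le_indicator_of_subset (hSmono hmn)
        (fun _ => zero_le) ξ
    · refine tendsto_const_nhds.congr' ?_
      filter_upwards [eventually_pow_mul_mem_integers hp ξ] with n hn
      exact (Set.indicator_of_mem (show ξ ∈ S n from hn) (fun ξ => ‖F ξ‖ₑ ^ 2)).symm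
  have h3 : Tendsto (fun n => ∫⁻ ξ, (S n).indicator (fun ξ => ‖F ξ‖ₑ ^ 2) ξ ∂μ) atTop
      (𝓝 (∫⁻ x, ‖u x‖ₑ ^ 2 ∂μ)) := by
    simp_rw [h1]
    have := (tendsto_integral_autocorrelation hμ hu2 hp)
    have h4 := ENNReal.tendsto_ofReal ((Complex.continuous_re.tendsto _).comp this)
    rw [Complex.ofReal_re, integral_norm_sq_eq_toReal hu2.1,
      ENNReal.ofReal_toReal (memLp_two_iff_lintegral.1 hu2).2.ne] at h4
    exact h4
  exact tendsto_nhds_unique h2 h3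

theorem eLpNorm_fourierIntegral (hμ : μ (integers K) = 1)
    (hχ : Continuous χ) (hχ_triv : ∀ x ∈ integers K, χ x = 1)
    (hχ_nontriv : ∃ x ∈ primeIdealInv K, χ x ≠ 1) {u : K → ℂ} (hu : Integrable u μ)
    (hu2 : MemLp u 2 μ) : eLpNorm (fourierIntegral χ μ u) 2 μ = eLpNorm u 2 μ :=
  eLpNorm_two_eq_iff.2 (lintegral_fourierIntegral_sq hμ hχ hχ_triv hχ_nontriv hu hu2)

theorem memLp_fourierIntegral (hμ : μ (integers K) = 1)
    (hχ : Continuous χ) (hχ_triv : ∀ x ∈ integers K, χ x = 1)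
    (hχ_nontriv : ∃ x ∈ primeIdealInv K, χ x ≠ 1) {u : K → ℂ} (hu : Integrable u μ)
    (hu2 : MemLp u 2 μ) : MemLp (fourierIntegral χ μ u) 2 μ :=
  ⟨(continuous_fourierIntegral hχ hu).aestronglyMeasurable,
    (eLpNorm_fourierIntegral hμ hχ hχ_triv hχ_nontriv hu hu2).trans_lt hu2.2⟩

/-- Continuous compactly supported functions approximate `f` in `L²`. The isometry on `L¹ ∩ L²`
makes their transforms a Cauchy sequence, and `L²` is complete. -/
theorem exists_isFourierL2 (hμ : μ (integers K) = 1)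
    (hχ : Continuous χ) (hχ_triv : ∀ x ∈ integers K, χ x = 1)
    (hχ_nontriv : ∃ x ∈ primeIdealInv K, χ x ≠ 1) {f : K → ℂ} (hf : MemLp f 2 μ) :
    ∃ g, IsFourierL2 χ μ f g := by
  have hn : ∀ n : ℕ, ((n : ℝ≥0∞) + 1)⁻¹ ≠ 0 := fun n => by simp
  choose u hucs hun huc hu2 using fun n : ℕ =>
    hf.exists_hasCompactSupport_eLpNorm_sub_le (by simp) (hn n)
  have hu1 : ∀ n, Integrable (u n) μ := fun n => (huc n).integrable_of_hasCompactSupport (hucs n)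
  have hF2 : ∀ n, MemLp (fourierIntegral χ μ (u n)) 2 μ := fun n =>
    memLp_fourierIntegral hμ hχ hχ_triv hχ_nontriv (hu1 n) (hu2 n)
  have hlim : Tendsto (fun n => eLpNorm (u n - f) 2 μ) atTop (𝓝 0) := by
    refine tendsto_of_tendsto_of_tendsto_of_le_of_le tendsto_const_nhds
      (h := fun n : ℕ => ((n : ℝ≥0∞) + 1)⁻¹) ?_ (fun n => zero_le) fun n => ?_
    · have := (tendsto_add_atTop_iff_nat 1).2 ENNReal.tendsto_inv_nat_nhds_zero
      simpa using this
    · exact (eLpNorm_sub_comm _ _ _ _).trans_le (hun n)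
  have hV := ((Lp.tendsto_Lp_iff_tendsto_eLpNorm'' u hu2 f hf).2 hlim).cauchySeq
  let G : ℕ → Lp ℂ 2 μ := fun n => (hF2 n).toLp _
  have hG : CauchySeq G := by
    rw [EMetric.cauchySeq_iff] at hV ⊢
    intro ε hε
    obtain ⟨N, hN⟩ := hV ε hε
    refine ⟨N, fun m hm n hn => ?_⟩
    have h1 := hN m hm n hn
    rw [Lp.edist_toLp_toLp] at h1 ⊢
    rwa [← fourierIntegral_sub hχ (hu1 m) (hu1 n),
      eLpNorm_fourierIntegral hμ hχ hχ_triv hχ_nontriv ((hu1 m).sub (hu1 n)) ((hu2 m).sub (hu2 n))]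
  obtain ⟨g, hg⟩ := cauchySeq_tendsto_of_complete hG
  refine ⟨g, Lp.memLp g, u, fun n => ⟨hu1 n, hu2 n⟩, hlim, ?_⟩
  rw [← Lp.tendsto_Lp_iff_tendsto_eLpNorm'' _ hF2 _ (Lp.memLp g), Lp.toLp_coeFn]
  exact hg

theorem isFourierL2_fourierL2 (hμ : μ (integers K) = 1)
    (hχ : Continuous χ) (hχ_triv : ∀ x ∈ integers K, χ x = 1)
    (hχ_nontriv : ∃ x ∈ primeIdealInv K, χ x ≠ 1) {f : K → ℂ} (hf : MemLp f 2 μ) :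
    IsFourierL2 χ μ f (fourierL2 χ μ f) := by
  have h := exists_isFourierL2 hμ hχ hχ_triv hχ_nontriv hf
  rw [fourierL2, dif_pos h]
  exact h.choose_spec

/-- Norms pass to the limit along the approximating sequence. Since this holds for any `L²`
transform `g`, uniqueness of `g` is not needed and representatives can be changed freely. -/
theorem IsFourierL2.lintegral_eq (hμ : μ (integers K) = 1)
    (hχ : Continuous χ) (hχ_triv : ∀ x ∈ integers K, χ x = 1)
    (hχ_nontriv : ∃ x ∈ primeIdealInv K, χ x ≠ 1) {f g : K → ℂ} (hf : MemLp f 2 μ)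
    (h : IsFourierL2 χ μ f g) : ∫⁻ x, ‖f x‖ₑ ^ 2 ∂μ = ∫⁻ x, ‖g x‖ₑ ^ 2 ∂μ := by
  obtain ⟨hg, u, hu, h1, h2⟩ := h
  have h3 := tendsto_eLpNorm_of_tendsto_sub (fun n => (hu n).2) hf h1
  have h4 := tendsto_eLpNorm_of_tendsto_sub (fun n =>
    memLp_fourierIntegral hμ hχ hχ_triv hχ_nontriv (hu n).1 (hu n).2) hg h2
  simp_rw [fun n => eLpNorm_fourierIntegral hμ hχ hχ_triv hχ_nontriv (hu n).1 (hu n).2] at h4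
  exact eLpNorm_two_eq_iff.1 (tendsto_nhds_unique h3 h4)

theorem tendsto_eLpNorm_add_const_mul {α : Type*} [MeasurableSpace α] {μ : Measure α}
    {u v : ℕ → α → ℂ} (hu : ∀ n, AEStronglyMeasurable (u n) μ)
    (hv : ∀ n, AEStronglyMeasurable (v n) μ)
    (h1 : Tendsto (fun n => eLpNorm (u n) 2 μ) atTop (𝓝 0))
    (h2 : Tendsto (fun n => eLpNorm (v n) 2 μ) atTop (𝓝 0)) (c : ℂ) :
    Tendsto (fun n => eLpNorm (u n + c • v n) 2 μ) atTop (𝓝 0) := by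
  have h3 : Tendsto (fun n => eLpNorm (u n) 2 μ + ‖c‖ₑ * eLpNorm (v n) 2 μ) atTop (𝓝 0) := by
    have := h1.add (ENNReal.Tendsto.const_mul h2 (Or.inr (enorm_ne_top (x := c))))
    simpa using this
  refine tendsto_of_tendsto_of_tendsto_of_le_of_le tendsto_const_nhds h3 (fun n => zero_le)
    fun n => ?_
  refine (eLpNorm_add_le (hu n) ((hv n).const_smul c) (by norm_num)).trans_eq ?_
  rw [eLpNorm_const_smul]

theorem IsFourierL2.add_const_smul (hχ : Continuous χ) {f g f' g' : K → ℂ}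
    (hf : MemLp f 2 μ) (hf' : MemLp f' 2 μ)
    (h : IsFourierL2 χ μ f g) (h' : IsFourierL2 χ μ f' g') (c : ℂ) :
    IsFourierL2 χ μ (f + c • f') (g + c • g') := by
  obtain ⟨hg, u, hu, h1, h2⟩ := h
  obtain ⟨hg', v, hv, h1', h2'⟩ := h'
  refine ⟨hg.add (hg'.const_smul c), fun n => u n + c • v n,
    fun n => ⟨(hu n).1.add ((hv n).1.smul c), (hu n).2.add ((hv n).2.const_smul c)⟩, ?_, ?_⟩
  · have := tendsto_eLpNorm_add_const_mul (fun n => ((hu n).2.sub hf).1)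
      (fun n => ((hv n).2.sub hf').1) h1 h1' c
    convert this using 3 with n
    rw [smul_sub]; exact add_sub_add_comm _ _ _ _
  · have hF : ∀ {w : K → ℂ}, Integrable w μ → AEStronglyMeasurable (fourierIntegral χ μ w) μ :=
      fun hw => (continuous_fourierIntegral hχ hw).aestronglyMeasurable
    have := tendsto_eLpNorm_add_const_mul (fun n => (hF (hu n).1).sub hg.1)
      (fun n => (hF (hv n).1).sub hg'.1) h2 h2' c
    convert this using 3 with n
    rw [fourierIntegral_add hχ (hu n).1 ((hv n).1.smul c), Fourier.fourierIntegral_const_smul,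
      smul_sub]
    exact add_sub_add_comm _ _ _ _

/-- Parseval's identity. -/
theorem IsFourierL2.integral_mul_conj (hμ : μ (integers K) = 1)
    (hχ : Continuous χ) (hχ_triv : ∀ x ∈ integers K, χ x = 1)
    (hχ_nontriv : ∃ x ∈ primeIdealInv K, χ x ≠ 1) {f g f' g' : K → ℂ}
    (hf : MemLp f 2 μ) (hf' : MemLp f' 2 μ)
    (h : IsFourierL2 χ μ f g) (h' : IsFourierL2 χ μ f' g') :
    ∫ x, f x * conj (f' x) ∂μ = ∫ ξ, g ξ * conj (g' ξ) ∂μ := by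
  have := integral_mul_conj_eq_of_lintegral_eq hf hf' h.1 h'.1 1 fun c => by
    rw [one_mul]
    exact (h.add_const_smul hχ hf hf' h' c).lintegral_eq hμ hχ hχ_triv
      hχ_nontriv (hf.add (hf'.const_smul c))
  simpa using this

end Plancherel

/-! ### The wavelet transform -/

section Wavelet

open Fourier (fourierIntegral)

variable {K : Type*} [Field K] [ValuativeRel K] [TopologicalSpace K]
    [IsNonarchimedeanLocalField K] [MeasurableSpace K] [BorelSpace K]
    {μ : Measure K} [μ.IsAddHaarMeasure] {χ : AddChar K Circle}

theorem quasiMeasurePreserving_sub_div {a : K} (ha : a ≠ 0) (b : K) :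
    Measure.QuasiMeasurePreserving (fun x => (x - b) / a) μ μ := by
  have h := (quasiMeasurePreserving_mul_left μ (inv_ne_zero ha)).comp
    (measurePreserving_sub_right μ b).quasiMeasurePreserving
  simpa only [Function.comp_def, div_eq_inv_mul] using h

/-- The convention `1 / 0 = 0` makes the prefactor vanish at `a = 0`, so several statements hold for
all `(a, b)`. -/
theorem daughter_zero (ψ : K → ℂ) (b x : K) : daughter ψ 0 b x = 0 := by simp [daughter]

theorem daughter_sub (u v : K → ℂ) (a b : K) :
    daughter (u - v) a b = daughter u a b - daughter v a b := by
  ext x; simp [daughter, mul_sub]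

theorem daughter_ae_congr {u v : K → ℂ} (h : u =ᵐ[μ] v) (a b : K) :
    daughter u a b =ᵐ[μ] daughter v a b := by
  by_cases ha : a = 0
  · subst ha; exact ae_of_all _ fun x => by simp [daughter_zero]
  · filter_upwards [(quasiMeasurePreserving_sub_div ha b).ae_eq_comp h] with x hx
    simp only [Function.comp_apply] at hx
    simp [daughter, hx]

theorem daughter_eq_const_mul (u : K → ℂ) (a b : K) :
    daughter u a b = fun x => ((1 / Real.sqrt (absVal a : ℝ) : ℝ) : ℂ) * u ((x - b) / a) := rfl

theorem integrable_daughter {u : K → ℂ} (hu : Integrable u μ) {a : K} (ha : a ≠ 0) (b : K) :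
    Integrable (daughter u a b) μ := by
  rw [daughter_eq_const_mul]
  refine Integrable.const_mul ?_ _
  have h := memLp_comp_mul_left μ (inv_ne_zero ha) (memLp_one_iff_integrable.2 hu)
  have h2 := (memLp_one_iff_integrable.1 h).comp_sub_right b
  simpa only [div_eq_inv_mul] using h2

theorem memLp_daughter {u : K → ℂ} (hu : MemLp u 2 μ) (a b : K) :
    MemLp (daughter u a b) 2 μ := by
  by_cases ha : a = 0
  · subst ha
    have : daughter u 0 b = 0 := funext (daughter_zero u b)
    rw [this]; exact MemLp.zero
  rw [daughter_eq_const_mul]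
  refine MemLp.const_mul ?_ _
  have h := (memLp_comp_mul_left μ (inv_ne_zero ha) hu).comp_measurePreserving
    (measurePreserving_sub_right μ b)
  simpa only [Function.comp_def, div_eq_inv_mul] using h

theorem enorm_sqrt_sq (r : ℝ≥0) : ‖((Real.sqrt (r : ℝ) : ℝ) : ℂ)‖ₑ ^ 2 = (r : ℝ≥0∞) := by
  rw [← ofReal_norm, Complex.norm_real, Real.norm_of_nonneg (Real.sqrt_nonneg _),
    ← ENNReal.ofReal_pow (Real.sqrt_nonneg _), Real.sq_sqrt r.coe_nonneg, ENNReal.ofReal_coe_nnreal]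

theorem eLpNorm_daughter (u : K → ℂ) {a : K} (ha : a ≠ 0) (b : K) :
    eLpNorm (daughter u a b) 2 μ = eLpNorm u 2 μ := by
  rw [eLpNorm_two_eq_iff]
  have h0 := absVal_ne_zero ha
  have h1 : ∀ x, ‖daughter u a b x‖ₑ ^ 2
      = (absVal a : ℝ≥0∞)⁻¹ * (fun y => ‖u (a⁻¹ * y)‖ₑ ^ 2) (x - b) := by
    intro x
    have : (1 / Real.sqrt (absVal a : ℝ)) = Real.sqrt ((absVal a)⁻¹ : ℝ≥0) := by
      simp
    rw [daughter, this, enorm_mul, mul_pow, enorm_sqrt_sq, div_eq_inv_mul, ENNReal.coe_inv h0]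
  simp_rw [h1]
  rw [lintegral_const_mul' _ _ (by simp [h0]), lintegral_sub_right_eq_self (fun y => ‖u (a⁻¹ * y)‖ₑ ^ 2) b,
    lintegral_comp_mul_left μ (inv_ne_zero ha) (fun y => ‖u y‖ₑ ^ 2), absVal_inv,
    ENNReal.coe_inv h0, inv_inv, ← mul_assoc, ENNReal.inv_mul_cancel (by simpa using h0) (by simp),
    one_mul]

/-- The Fourier transform of a daughter wavelet, in terms of that of the wavelet. -/
noncomputable def daughterFourier (χ : AddChar K Circle) (g : K → ℂ) (a b ξ : K) : ℂ :=
  ((Real.sqrt (absVal a : ℝ) : ℝ) : ℂ) * ((χ (-(b * ξ)) : ℂ) * g (a * ξ))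

theorem eLpNorm_daughterFourier (g : K → ℂ) {a : K} (ha : a ≠ 0) (b : K) :
    eLpNorm (daughterFourier χ g a b) 2 μ = eLpNorm g 2 μ := by
  rw [eLpNorm_two_eq_iff]
  have h0 := absVal_ne_zero ha
  have h1 : ∀ ξ, ‖daughterFourier χ g a b ξ‖ₑ ^ 2
      = (absVal a : ℝ≥0∞) * (fun y => ‖g y‖ₑ ^ 2) (a * ξ) := by
    intro ξ
    have : ‖(χ (-(b * ξ)) : ℂ)‖ₑ = 1 := by rw [← ofReal_norm, Circle.norm_coe]; simp
    rw [daughterFourier, enorm_mul, mul_pow, enorm_sqrt_sq, enorm_mul, this, one_mul]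
  simp_rw [h1]
  rw [lintegral_const_mul' _ _ (by simp), lintegral_comp_mul_left μ ha (fun y => ‖g y‖ₑ ^ 2), ← mul_assoc,
    ENNReal.mul_inv_cancel (by simpa using h0) (by simp), one_mul]

theorem fourierIntegral_daughter (u : K → ℂ) {a : K} (ha : a ≠ 0) (b : K) :
    fourierIntegral χ μ (daughter u a b) = daughterFourier χ (fourierIntegral χ μ u) a b := by
  ext ξ
  have h0 : (absVal a : ℝ) ≠ 0 := by exact_mod_cast absVal_ne_zero ha
  have h1 := fourierIntegral_comp_mul_left (μ := μ) (χ := χ) (inv_ne_zero ha) u ξ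
  rw [inv_inv, absVal_inv, NNReal.coe_inv, Complex.ofReal_inv, inv_inv] at h1
  have h2 : fourierIntegral χ μ (daughter u a b) ξ
      = ((1 / Real.sqrt (absVal a : ℝ) : ℝ) : ℂ) * ((χ (-(b * ξ)) : ℂ) *
        fourierIntegral χ μ (fun x => u (a⁻¹ * x)) ξ) := by
    rw [fourierIntegral_eq_mul, fourierIntegral_eq_mul, ← integral_add_right_eq_self _ b,
      ← integral_const_mul, ← integral_const_mul]
    refine integral_congr_ae (ae_of_all _ fun x => ?_)
    have e2 : -((x + b) * ξ) = -(b * ξ) + -(x * ξ) := by ring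
    simp only [daughter, e2, AddChar.map_add_eq_mul, Circle.coe_mul, add_sub_cancel_right,
      div_eq_inv_mul]
    ring
  have h3 : ((1 / Real.sqrt (absVal a : ℝ) : ℝ) : ℂ) * ((absVal a : ℝ) : ℂ)
      = ((Real.sqrt (absVal a : ℝ) : ℝ) : ℂ) := by
    rw [← Complex.ofReal_mul]
    congr 1
    rw [one_div, inv_mul_eq_div, Real.div_sqrt]
  rw [h2, h1, daughterFourier, ← h3]
  ring

theorem aestronglyMeasurable_daughterFourier (hχ : Continuous χ) {g : K → ℂ}
    (hg : MemLp g 2 μ) {a : K} (ha : a ≠ 0) (b : K) :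
    AEStronglyMeasurable (daughterFourier χ g a b) μ := by
  refine AEStronglyMeasurable.const_mul ?_ _
  have hc : Continuous fun ξ => (χ (-(b * ξ)) : ℂ) :=
    continuous_induced_dom.comp (hχ.comp (by fun_prop))
  exact hc.aestronglyMeasurable.mul (memLp_comp_mul_left μ ha hg).1

/-- On both sides, passing to `(a, b)` is linear and preserves `L²` norms, so an approximating
sequence for `ψ` is carried to one for the daughter wavelet. -/
theorem IsFourierL2.daughter (hχ : Continuous χ) {ψ g : K → ℂ} (h : IsFourierL2 χ μ ψ g)
    {a : K} (ha : a ≠ 0) (b : K) :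
    IsFourierL2 χ μ (daughter ψ a b) (daughterFourier χ g a b) := by
  obtain ⟨hg, u, hu, h1, h2⟩ := h
  refine ⟨⟨aestronglyMeasurable_daughterFourier hχ hg ha b, ?_⟩,
    fun n => LocalFieldWavelet.daughter (u n) a b,
    fun n => ⟨integrable_daughter (hu n).1 ha b, memLp_daughter (hu n).2 a b⟩, ?_, ?_⟩
  · rw [eLpNorm_daughterFourier g ha b]; exact hg.2
  · simpa only [← daughter_sub, eLpNorm_daughter _ ha b] using h1
  · have hs : ∀ n, daughterFourier χ (fourierIntegral χ μ (u n)) a b - daughterFourier χ g a b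
        = daughterFourier χ (fourierIntegral χ μ (u n) - g) a b := fun n => by
      ext ξ; simp [daughterFourier, mul_sub]
    simpa only [fourierIntegral_daughter _ ha b, hs, eLpNorm_daughterFourier _ ha b] using h2

theorem IsFourierL2.congr_right {f g g' : K → ℂ} (h : IsFourierL2 χ μ f g) (hg : g =ᵐ[μ] g') :
    IsFourierL2 χ μ f g' := by
  obtain ⟨h0, u, hu, h1, h2⟩ := h
  refine ⟨(memLp_congr_ae hg).1 h0, u, hu, h1, ?_⟩
  simpa only [eLpNorm_congr_ae (EventuallyEq.rfl.sub hg)] using h2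

theorem cwt_congr {ψ ψ' f f' : K → ℂ} (hψ : ψ =ᵐ[μ] ψ') (hf : f =ᵐ[μ] f') (a b : K) :
    cwt μ ψ f a b = cwt μ ψ' f' a b := by
  refine integral_congr_ae ?_
  filter_upwards [hf, daughter_ae_congr hψ a b] with x h1 h2
  rw [h1, h2]

theorem MemLp.integrable_mul_conj {α : Type*} [MeasurableSpace α] {μ : Measure α} {f g : α → ℂ}
    (hf : MemLp f 2 μ) (hg : MemLp g 2 μ) : Integrable (fun x => f x * conj (g x)) μ :=
  hf.integrable_mul (q := 2) hg.star

theorem cwt_add_const_smul {ψ f f' : K → ℂ} (hψ : MemLp ψ 2 μ) (hf : MemLp f 2 μ)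
    (hf' : MemLp f' 2 μ) (c : ℂ) (a b : K) :
    cwt μ ψ (f + c • f') a b = cwt μ ψ f a b + c * cwt μ ψ f' a b := by
  rw [cwt, cwt, cwt, ← integral_const_mul, ← integral_add]
  · refine integral_congr_ae (ae_of_all _ fun x => ?_)
    simp only [Pi.add_apply, Pi.smul_apply, smul_eq_mul]
    ring
  · exact MemLp.integrable_mul_conj hf (memLp_daughter hψ a b)
  · exact (MemLp.integrable_mul_conj hf' (memLp_daughter hψ a b)).const_mul c

/-- Changing `ψ` and `f` on null sets leaves the transform unchanged at every `(a, b)`, so both may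
be taken strongly measurable; the integrand is then jointly measurable. -/
theorem stronglyMeasurable_cwt {ψ f : K → ℂ} (hψ : AEStronglyMeasurable ψ μ)
    (hf : AEStronglyMeasurable f μ) :
    StronglyMeasurable fun p : K × K => cwt μ ψ f p.1 p.2 := by
  obtain ⟨ψ', hψ', hψe⟩ := hψ
  obtain ⟨f', hf', hfe⟩ := hf
  have : (fun p : K × K => cwt μ ψ f p.1 p.2) = fun p => cwt μ ψ' f' p.1 p.2 :=
    funext fun p => cwt_congr hψe hfe p.1 p.2
  rw [this]
  refine StronglyMeasurable.integral_prod_right'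
    (f := fun q : (K × K) × K => f' q.2 * conj (daughter ψ' q.1.1 q.1.2 q.2)) ?_
  refine Measurable.stronglyMeasurable ?_
  have hf'm := hf'.measurable
  have hψm := hψ'.measurable
  have habs := measurable_absVal (K := K)
  have hconj : Measurable (fun z : ℂ => conj z) := Complex.continuous_conj.measurable
  refine (hf'm.comp measurable_snd).mul (hconj.comp (Measurable.mul ?_ ?_))
  · refine Complex.measurable_ofReal.comp (Measurable.const_div ?_ _)
    exact Real.continuous_sqrt.measurable.comp
      (measurable_coe_nnreal_real.comp (habs.comp (measurable_fst.comp measurable_fst)))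
  · exact hψm.comp ((measurable_snd.sub (measurable_snd.comp measurable_fst)).div
      (measurable_fst.comp measurable_fst))

/-- Parseval against the transform of the daughter wavelet, whose phase `χ(-bξ)` becomes, after
conjugation, the kernel of a Fourier integral at `-b`. -/
theorem cwt_eq_fourierIntegral (hμ : μ (integers K) = 1)
    (hχ : Continuous χ) (hχ_triv : ∀ x ∈ integers K, χ x = 1)
    (hχ_nontriv : ∃ x ∈ primeIdealInv K, χ x ≠ 1) {ψ g f φ : K → ℂ} (hψ : MemLp ψ 2 μ)
    (hf : MemLp f 2 μ) (hg : IsFourierL2 χ μ ψ g) (hφ : IsFourierL2 χ μ f φ)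
    {a : K} (ha : a ≠ 0) (b : K) :
    cwt μ ψ f a b = ((Real.sqrt (absVal a : ℝ) : ℝ) : ℂ) *
      fourierIntegral χ μ (fun ξ => φ ξ * conj (g (a * ξ))) (-b) := by
  rw [cwt, hφ.integral_mul_conj hμ hχ hχ_triv hχ_nontriv hf (memLp_daughter hψ a b)
    (hg.daughter hχ ha b), fourierIntegral_eq_mul, ← integral_const_mul]
  refine integral_congr_ae (ae_of_all _ fun ξ => ?_)
  have e : -(ξ * -b) = b * ξ := by ring
  simp only [daughterFourier, map_mul, Complex.conj_ofReal, AddChar.map_neg_eq_inv,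
    Circle.coe_inv_eq_conj, Complex.conj_conj, e]
  ring

/-- Plancherel for `φ(ξ) conj(g(aξ))`. As a product of two `L²` functions it is in `L¹`; `hfin` puts
it in `L²` as well. -/
theorem lintegral_cwt_slice (hμ : μ (integers K) = 1)
    (hχ : Continuous χ) (hχ_triv : ∀ x ∈ integers K, χ x = 1)
    (hχ_nontriv : ∃ x ∈ primeIdealInv K, χ x ≠ 1) {ψ g f φ : K → ℂ} (hψ : MemLp ψ 2 μ)
    (hf : MemLp f 2 μ) (hg : IsFourierL2 χ μ ψ g) (hφ : IsFourierL2 χ μ f φ)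
    {a : K} (ha : a ≠ 0) (hfin : ∫⁻ ξ, ‖φ ξ‖ₑ ^ 2 * ‖g (a * ξ)‖ₑ ^ 2 ∂μ < ∞) :
    ∫⁻ b, ‖cwt μ ψ f a b‖ₑ ^ 2 ∂μ
      = absVal a * ∫⁻ ξ, ‖φ ξ‖ₑ ^ 2 * ‖g (a * ξ)‖ₑ ^ 2 ∂μ := by
  have hga : MemLp (fun ξ => g (a * ξ)) 2 μ := memLp_comp_mul_left μ ha hg.1
  have h1 : Integrable (fun ξ => φ ξ * conj (g (a * ξ))) μ := MemLp.integrable_mul_conj hφ.1 hga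
  have he : ∀ ξ, ‖φ ξ * conj (g (a * ξ))‖ₑ ^ 2 = ‖φ ξ‖ₑ ^ 2 * ‖g (a * ξ)‖ₑ ^ 2 := fun ξ => by
    rw [enorm_mul, mul_pow, RCLike.enorm_conj]
  have h2 : MemLp (fun ξ => φ ξ * conj (g (a * ξ))) 2 μ := by
    rw [memLp_two_iff_lintegral]
    exact ⟨h1.1, by simpa only [he] using hfin⟩
  have h3 := lintegral_fourierIntegral_sq hμ hχ hχ_triv hχ_nontriv h1 h2
  simp only [he] at h3
  simp_rw [cwt_eq_fourierIntegral hμ hχ hχ_triv hχ_nontriv hψ hf hg hφ ha, enorm_mul, mul_pow,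
    enorm_sqrt_sq]
  rw [lintegral_const_mul' _ _ (by simp), ← h3,
    lintegral_neg_eq_self (fun b => ‖fourierIntegral χ μ (fun ξ => φ ξ * conj (g (a * ξ))) b‖ₑ ^ 2)]

/-- The measure `da/|a|` is invariant under `a ↦ ξa`. This is where the weight `1/|ξ|` of the
admissibility constant comes from. -/
theorem lintegral_scaled_div_absVal (g : K → ℂ) {ξ : K} (hξ : ξ ≠ 0) :
    ∫⁻ a, ‖g (a * ξ)‖ₑ ^ 2 * (absVal a : ℝ≥0∞)⁻¹ ∂μ
      = ∫⁻ η, ‖g η‖ₑ ^ 2 / (absVal η : ℝ≥0∞) ∂μ := by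
  have h0 : (absVal ξ : ℝ≥0∞) ≠ 0 := by simpa using absVal_ne_zero hξ
  have h1 : ∀ᵐ a ∂μ, ‖g (a * ξ)‖ₑ ^ 2 * (absVal a : ℝ≥0∞)⁻¹
      = absVal ξ * (fun η => ‖g η‖ₑ ^ 2 / (absVal η : ℝ≥0∞)) (ξ * a) := by
    filter_upwards [ae_ne_zero μ] with a ha
    rw [absVal_mul, ENNReal.coe_mul, div_eq_mul_inv,
      ENNReal.mul_inv (Or.inl h0) (Or.inl ENNReal.coe_ne_top), mul_comm a ξ]
    rw [mul_left_comm (absVal ξ : ℝ≥0∞), ← mul_assoc (absVal ξ : ℝ≥0∞),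
      ENNReal.mul_inv_cancel h0 ENNReal.coe_ne_top, one_mul]
  rw [lintegral_congr_ae h1, lintegral_const_mul' _ _ ENNReal.coe_ne_top,
    lintegral_comp_mul_left μ hξ (fun η => ‖g η‖ₑ ^ 2 / (absVal η : ℝ≥0∞)), ← mul_assoc, ENNReal.mul_inv_cancel h0 ENNReal.coe_ne_top,
    one_mul]

theorem lintegral_lintegral_fourier_scaled {g φ : K → ℂ} (hg : Measurable g) (hφ : Measurable φ) :
    ∫⁻ a, ∫⁻ ξ, ‖φ ξ‖ₑ ^ 2 * ‖g (a * ξ)‖ₑ ^ 2 * (absVal a : ℝ≥0∞)⁻¹ ∂μ ∂μ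
      = (∫⁻ η, ‖g η‖ₑ ^ 2 / (absVal η : ℝ≥0∞) ∂μ) * ∫⁻ ξ, ‖φ ξ‖ₑ ^ 2 ∂μ := by
  have habs := measurable_absVal (K := K)
  rw [lintegral_lintegral_swap]
  · rw [mul_comm, ← lintegral_mul_const _ (hφ.enorm.pow_const 2)]
    refine lintegral_congr_ae ?_
    filter_upwards [ae_ne_zero μ] with ξ hξ
    simp_rw [mul_assoc]
    rw [lintegral_const_mul' _ _ (by simp), lintegral_scaled_div_absVal g hξ]
  · exact (((hφ.enorm.pow_const 2).comp measurable_snd).mul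
      ((hg.enorm.pow_const 2).comp (measurable_fst.mul measurable_snd))).mul
      ((habs.coe_nnreal_ennreal.inv).comp measurable_fst) |>.aemeasurable

theorem lintegral_cwt_sq_of_isFourierL2 (hμ : μ (integers K) = 1)
    (hχ : Continuous χ) (hχ_triv : ∀ x ∈ integers K, χ x = 1)
    (hχ_nontriv : ∃ x ∈ primeIdealInv K, χ x ≠ 1) {ψ g f φ : K → ℂ} (hψ : MemLp ψ 2 μ)
    (hf : MemLp f 2 μ) (hg : IsFourierL2 χ μ ψ g) (hφ : IsFourierL2 χ μ f φ)
    (hgm : Measurable g) (hφm : Measurable φ)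
    (hfin : ∫⁻ η, ‖g η‖ₑ ^ 2 / (absVal η : ℝ≥0∞) ∂μ < ∞) :
    ∫⁻ p : K × K, ‖cwt μ ψ f p.1 p.2‖ₑ ^ 2 ∂(scaleMeasure μ)
      = (∫⁻ η, ‖g η‖ₑ ^ 2 / (absVal η : ℝ≥0∞) ∂μ) * ∫⁻ x, ‖f x‖ₑ ^ 2 ∂μ := by
  have habs := measurable_absVal (K := K)
  have hw : Measurable fun p : K × K => (((absVal p.1 ^ 2)⁻¹ : ℝ≥0) : ℝ≥0∞) :=
    (((habs.comp measurable_fst).pow_const 2).inv).coe_nnreal_ennreal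
  have hc := ((stronglyMeasurable_cwt (μ := μ) hψ.1 hf.1).measurable.enorm).pow_const 2
  have hf2 := (memLp_two_iff_lintegral.1 hf).2
  rw [hφ.lintegral_eq hμ hχ hχ_triv hχ_nontriv hf] at hf2 ⊢
  have hm : Measurable fun q : K × K => ‖φ q.2‖ₑ ^ 2 * ‖g (q.1 * q.2)‖ₑ ^ 2 :=
    ((hφm.enorm.pow_const 2).comp measurable_snd).mul
      ((hgm.enorm.pow_const 2).comp (measurable_fst.mul measurable_snd))
  have hT := lintegral_lintegral_fourier_scaled (μ := μ) hgm hφm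
  have hconst : ∀ᵐ a ∂μ, ∫⁻ ξ, ‖φ ξ‖ₑ ^ 2 * ‖g (a * ξ)‖ₑ ^ 2 * (absVal a : ℝ≥0∞)⁻¹ ∂μ
      = (∫⁻ ξ, ‖φ ξ‖ₑ ^ 2 * ‖g (a * ξ)‖ₑ ^ 2 ∂μ) * (absVal a : ℝ≥0∞)⁻¹ := by
    filter_upwards [ae_ne_zero μ] with a ha
    exact lintegral_mul_const' _ _ (by simpa using absVal_ne_zero ha)
  rw [lintegral_congr_ae hconst] at hT
  rw [← hT, scaleMeasure, lintegral_withDensity_eq_lintegral_mul _ hw hc,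
    lintegral_prod _ (hw.mul hc).aemeasurable]
  -- The total integral is `c_ψ ‖φ‖² < ∞`, so almost every slice is finite, as `lintegral_cwt_slice`
  -- requires.
  have hlt : ∀ᵐ a ∂μ, (∫⁻ ξ, ‖φ ξ‖ₑ ^ 2 * ‖g (a * ξ)‖ₑ ^ 2 ∂μ) * (absVal a : ℝ≥0∞)⁻¹ < ∞ := by
    refine ae_lt_top (hm.lintegral_prod_right'.mul habs.coe_nnreal_ennreal.inv) ?_
    rw [hT]
    exact ENNReal.mul_ne_top hfin.ne hf2.ne
  refine lintegral_congr_ae ?_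
  filter_upwards [hlt, ae_ne_zero μ] with a hlt ha
  have h0 : (absVal a : ℝ≥0∞) ≠ 0 := by simpa using absVal_ne_zero ha
  have hfa : ∫⁻ ξ, ‖φ ξ‖ₑ ^ 2 * ‖g (a * ξ)‖ₑ ^ 2 ∂μ < ∞ := by
    by_contra hcon
    rw [not_lt, top_le_iff] at hcon
    rw [hcon, ENNReal.top_mul (by simp)] at hlt
    exact lt_irrefl _ hlt
  simp only [Pi.mul_apply]
  rw [lintegral_const_mul' _ _ ENNReal.coe_ne_top,
    lintegral_cwt_slice hμ hχ hχ_triv hχ_nontriv hψ hf hg hφ ha hfa,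
    ENNReal.coe_inv (pow_ne_zero 2 (absVal_ne_zero ha)), ENNReal.coe_pow, ← mul_assoc, mul_comm]
  congr 1
  rw [sq, ENNReal.mul_inv (Or.inl h0) (Or.inl ENNReal.coe_ne_top), mul_assoc,
    ENNReal.inv_mul_cancel h0 ENNReal.coe_ne_top, mul_one]

/-- The wavelet transform scales `L²` norms by the admissibility constant. -/
theorem lintegral_cwt_sq (hμ : μ (integers K) = 1)
    (hχ : Continuous χ) (hχ_triv : ∀ x ∈ integers K, χ x = 1)
    (hχ_nontriv : ∃ x ∈ primeIdealInv K, χ x ≠ 1) {ψ f : K → ℂ} (hψ : IsAdmissible χ μ ψ)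
    (hf : MemLp f 2 μ) :
    ∫⁻ p : K × K, ‖cwt μ ψ f p.1 p.2‖ₑ ^ 2 ∂(scaleMeasure μ)
      = admissibilityConst χ μ ψ * ∫⁻ x, ‖f x‖ₑ ^ 2 ∂μ := by
  have hg := isFourierL2_fourierL2 hμ hχ hχ_triv hχ_nontriv hψ.memLp
  have hφ := isFourierL2_fourierL2 hμ hχ hχ_triv hχ_nontriv hf
  -- Tonelli for `g(aξ)` uses measurable representatives; the admissibility constant sees `g` only
  -- up to null sets.
  obtain ⟨g, hgm, hge⟩ := hg.1.1
  obtain ⟨φ, hφm, hφe⟩ := hφ.1.1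
  have hC : admissibilityConst χ μ ψ = ∫⁻ η, ‖g η‖ₑ ^ 2 / (absVal η : ℝ≥0∞) ∂μ := by
    refine lintegral_congr_ae ?_
    filter_upwards [hge] with η hη
    rw [hη]
  rw [hC]
  exact lintegral_cwt_sq_of_isFourierL2 hμ hχ hχ_triv hχ_nontriv hψ.memLp hf
    (hg.congr_right hge) (hφ.congr_right hφe) hgm.measurable hφm.measurable
    (hC ▸ hψ.const_lt_top)

/-- The weight `1/|ξ|` never vanishes, so `c_ψ = 0` forces the transform of `ψ` to be `0` almost
everywhere, and then `ψ` too by Plancherel. -/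
theorem admissibilityConst_ne_zero (hμ : μ (integers K) = 1)
    (hχ : Continuous χ) (hχ_triv : ∀ x ∈ integers K, χ x = 1)
    (hχ_nontriv : ∃ x ∈ primeIdealInv K, χ x ≠ 1) {ψ : K → ℂ} (hψ : MemLp ψ 2 μ)
    (hψ_ne : ¬ ψ =ᵐ[μ] 0) : admissibilityConst χ μ ψ ≠ 0 := by
  intro h
  apply hψ_ne
  have hg := isFourierL2_fourierL2 hμ hχ hχ_triv hχ_nontriv hψ
  have h1 : ∀ᵐ ξ ∂μ, ‖fourierL2 χ μ ψ ξ‖ₑ ^ 2 / (absVal ξ : ℝ≥0∞) = 0 := by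
    refine (lintegral_eq_zero_iff' ?_).1 h
    exact (hg.1.1.enorm.pow_const 2).div (measurable_absVal.coe_nnreal_ennreal).aemeasurable
  have h2 : ∫⁻ x, ‖ψ x‖ₑ ^ 2 ∂μ = 0 := by
    rw [hg.lintegral_eq hμ hχ hχ_triv hχ_nontriv hψ, lintegral_congr_ae (g := fun _ => 0)]
    · simp
    · filter_upwards [h1] with ξ hξ
      exact (ENNReal.div_eq_zero_iff.1 hξ).resolve_right ENNReal.coe_ne_top
  filter_upwards [(lintegral_eq_zero_iff' (hψ.1.enorm.pow_const 2)).1 h2] with x hx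
  simpa using hx

theorem memLp_cwt (hμ : μ (integers K) = 1)
    (hχ : Continuous χ) (hχ_triv : ∀ x ∈ integers K, χ x = 1)
    (hχ_nontriv : ∃ x ∈ primeIdealInv K, χ x ≠ 1) {ψ f : K → ℂ} (hψ : IsAdmissible χ μ ψ)
    (hf : MemLp f 2 μ) :
    MemLp (fun p : K × K => cwt μ ψ f p.1 p.2) 2 (scaleMeasure μ) := by
  rw [memLp_two_iff_lintegral, lintegral_cwt_sq hμ hχ hχ_triv hχ_nontriv hψ hf]
  exact ⟨(stronglyMeasurable_cwt hψ.memLp.1 hf.1).aestronglyMeasurable,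
    ENNReal.mul_lt_top hψ.const_lt_top (memLp_two_iff_lintegral.1 hf).2⟩

theorem integral_cwt_mul_daughter_mul_conj (ψ f h : K → ℂ) (a b : K) :
    ∫ x, (cwt μ ψ f a b * daughter ψ a b x) * conj (h x) ∂μ
      = cwt μ ψ f a b * conj (cwt μ ψ h a b) := by
  simp_rw [mul_assoc]
  rw [integral_const_mul]
  congr 1
  rw [cwt, ← integral_conj]
  refine integral_congr_ae (ae_of_all _ fun x => ?_)
  simp [mul_comm]

end Wavelet

end LocalFieldWavelet

theorem mainTheorem2 {K : Type*} [Field K] [ValuativeRel K] [TopologicalSpace K]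
    [IsNonarchimedeanLocalField K] [MeasurableSpace K] [BorelSpace K]
    (μ : Measure K) [μ.IsAddHaarMeasure] (hμ : μ (LocalFieldWavelet.integers K) = 1)
    (χ : AddChar K Circle) (hχ : Continuous χ)
    (hχ_triv : ∀ x ∈ LocalFieldWavelet.integers K, χ x = 1)
    (hχ_nontriv : ∃ x ∈ LocalFieldWavelet.primeIdealInv K, χ x ≠ 1)
    (ψ : K → ℂ) (hψ : LocalFieldWavelet.IsAdmissible χ μ ψ) (hψ_ne : ¬ ψ =ᵐ[μ] 0)
    (f : K → ℂ) (hf : MemLp f 2 μ) (h : K → ℂ) (hh : MemLp h 2 μ) :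
    Integrable
      (fun p : K × K =>
        ∫ x, (LocalFieldWavelet.cwt μ ψ f p.1 p.2 * LocalFieldWavelet.daughter ψ p.1 p.2 x)
          * conj (h x) ∂μ)
      (LocalFieldWavelet.scaleMeasure μ) ∧
    ∫ x, f x * conj (h x) ∂μ =
      (1 / ((LocalFieldWavelet.admissibilityConst χ μ ψ).toReal : ℂ)) *
        ∫ p : K × K,
          (∫ x, (LocalFieldWavelet.cwt μ ψ f p.1 p.2 * LocalFieldWavelet.daughter ψ p.1 p.2 x)
            * conj (h x) ∂μ)
          ∂(LocalFieldWavelet.scaleMeasure μ) := by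
  have hWf := LocalFieldWavelet.memLp_cwt hμ hχ hχ_triv hχ_nontriv hψ hf
  have hWh := LocalFieldWavelet.memLp_cwt hμ hχ hχ_triv hχ_nontriv hψ hh
  have hC : ((LocalFieldWavelet.admissibilityConst χ μ ψ).toReal : ℂ) ≠ 0 := by
    rw [Complex.ofReal_ne_zero]
    exact ENNReal.toReal_ne_zero.2 ⟨LocalFieldWavelet.admissibilityConst_ne_zero hμ hχ hχ_triv
      hχ_nontriv hψ.memLp hψ_ne, hψ.const_lt_top.ne⟩
  simp only [LocalFieldWavelet.integral_cwt_mul_daughter_mul_conj]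
  refine ⟨LocalFieldWavelet.MemLp.integrable_mul_conj hWf hWh, ?_⟩
  -- Polarization: the transform is linear in `f`, so the norm identity for all `f + c • h` yields
  -- the identity of inner products.
  rw [LocalFieldWavelet.integral_mul_conj_eq_of_lintegral_eq hWf hWh hf hh
    (LocalFieldWavelet.admissibilityConst χ μ ψ) fun c => ?_, one_div, inv_mul_cancel_left₀ hC]
  simp_rw [← LocalFieldWavelet.cwt_add_const_smul hψ.memLp hf hh]
  exact LocalFieldWavelet.lintegral_cwt_sq hμ hχ hχ_triv hχ_nontriv hψ
    (hf.add (hh.const_smul c))
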